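/- All graphs are finite and simple, and all colorings are edge colorings. A copy of a graph is a (not necessarily induced) subgraph isomorphic to it; it is rainbow if its edges have pairwise different colors, and monochromatic if all its edges have one color. For a graph $H$ and a positive integer $k$, let $R_k(H)$ be the minimum integer $n$ such that every coloring of $K_n$ using at most $k$ colors contains a monochromatic copy of $H$. For graphs $G$ and $H$, let $gr_k(G : H)$ be the minimum integer $n$ such that every coloring of $K_n$ using at most $k$ colors contains a rainbow copy of $G$ or a monochromatic copy of $H$. Let $P_5$ be the path on $5$ vertices, $K_3$ the triangle, $C_5$ the cycle on $5$ vertices, and $mH$ the disjoint union of $m$ copies of $H$. Then for all integers $m \ge 2$ and $k \ge 3$ these numbers exist for $H = mK_3$ and $H = mC_5$, and 1. $gr_k(P_5 : mK_3) = R_3(mK_3)$; 2. $gr_k(P_5 : mC_5) = R_3(mC_5)$. -/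

import Mathlib

namespace GallaiRamsey

open SimpleGraph

/-- The disjoint union `mH` of `m` copies of the graph `H`. -/
def disjointCopies {V : Type*} (m : ℕ) (H : SimpleGraph V) : SimpleGraph (Fin m × V) where
  Adj x y := x.1 = y.1 ∧ H.Adj x.2 y.2
  symm := ⟨fun _ _ h => ⟨h.1.symm, h.2.symm⟩⟩
  loopless := ⟨fun x h => H.loopless.irrefl x.2 h.2⟩

/-- The edge-colored complete graph on `V` contains a monochromatic copy of `H`
(as a not necessarily induced subgraph). -/
def HasMonochromaticCopy {V W K : Type*} (C : TopEdgeLabeling V K) (H : SimpleGraph W) : Prop :=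
  ∃ c : K, H.IsContained (C.labelGraph c)

/-- The edge-colored complete graph on `V` contains a rainbow copy of `G`: a copy of `G` whose
edges have pairwise different colors. -/
def HasRainbowCopy {V W K : Type*} (C : TopEdgeLabeling V K) (G : SimpleGraph W) : Prop :=
  ∃ f : Copy G (⊤ : SimpleGraph V),
    Function.Injective fun e : G.edgeSet => C (f.toHom.mapEdgeSet e)

/-- The orders `n` such that every coloring of the edges of `K_n` using at most `k` colors
contains a monochromatic copy of `H`. -/
def ramseySet {W : Type*} (k : ℕ) (H : SimpleGraph W) : Set ℕ :=
  {n | ∀ C : TopEdgeLabeling (Fin n) (Fin k), HasMonochromaticCopy C H}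

/-- The `k`-color Ramsey number `R_k(H)`, the minimum of `ramseySet k H`. -/
noncomputable def ramseyNumber {W : Type*} (k : ℕ) (H : SimpleGraph W) : ℕ :=
  sInf (ramseySet k H)

/-- The orders `n` such that every coloring of the edges of `K_n` using at most `k` colors
contains a rainbow copy of `G` or a monochromatic copy of `H`. -/
def gallaiRamseySet {W W' : Type*} (k : ℕ) (G : SimpleGraph W) (H : SimpleGraph W') : Set ℕ :=
  {n | ∀ C : TopEdgeLabeling (Fin n) (Fin k), HasRainbowCopy C G ∨ HasMonochromaticCopy C H}

/-- The Gallai-Ramsey number `gr_k(G : H)`, the minimum of `gallaiRamseySet k G H`. -/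
noncomputable def gallaiRamseyNumber {W W' : Type*} (k : ℕ) (G : SimpleGraph W)
    (H : SimpleGraph W') : ℕ :=
  sInf (gallaiRamseySet k G H)

end GallaiRamsey

/-!
A coloring without a rainbow `P₅` on at least six vertices uses at most three colors, or is
monochromatic outside a set of at most five vertices, or has a dominant color `D` together with a
partition of the vertices such that all edges between parts have color `D` and each part uses `D`
and at most one further color. Indeed, outside the first two cases no vertex meets three colors; the
color sets at the vertices have size at most two and pairwise intersect, and as more than three
colors occur they have a common element `D`.

Let `H` be `K₃` (`a = 1`) or `C₅` (`a = 2`): it has color classes of sizes `a`, `a` and `1`, and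
independence number `a`. Coloring the edges by the larger of the levels of their ends, for levels of
sizes `m(2a+1) - 1`, `m(a+1) - 1` and `m(a+1) - 1`, shows `R₃(mH) ≥ m(4a+3) - 2`. On that many
vertices a nearly monochromatic coloring contains `mH` outright. With a dominant color, the parts
either can be grouped into three classes large enough to hold `mH` in color `D`, or one or two
parts dominate. In the latter case a suitable 3-coloring has a monochromatic `mH`, which is already
monochromatic in the original coloring except for copies of `H` using a vertex outside the
dominating parts, and these copies can be replaced by tripartite ones in color `D`.
-/

namespace GallaiRamsey

open SimpleGraph Finset

section Structure
variable {V K : Type*}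

/-- A coloring `c` of the edges of the complete graph on `V` without rainbow path on five vertices,
encoded as a function on pairs of vertices whose diagonal values are irrelevant. -/
def RainbowPathFree (c : V → V → K) : Prop :=
  ∀ x₁ x₂ x₃ x₄ x₅ : V, [x₁, x₂, x₃, x₄, x₅].Nodup →
    ¬ [c x₁ x₂, c x₂ x₃, c x₃ x₄, c x₄ x₅].Nodup

/-- The vertices `v, p, q, r, s` span a rainbow chair: a star with center `v` and leaves `p, q, r`
together with the pendant edge `rs`. -/
def IsRainbowChair (c : V → V → K) (v p q r s : V) : Prop :=
  [v, p, q, r, s].Nodup ∧ [c v p, c v q, c v r, c r s].Nodup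

/-- All edges avoiding some set of at most five vertices have the same color. -/
def NearlyMonochromatic (c : V → V → K) : Prop :=
  ∃ (S : Finset V) (d : K), #S ≤ 5 ∧ ∀ x ∉ S, ∀ y ∉ S, x ≠ y → c x y = d

/-- All edges of the complete graph on `V` have one of three colors. -/
def UsesAtMostThreeColors (c : V → V → K) : Prop :=
  ∃ g : Fin 3 → K, ∀ x y, x ≠ y → c x y ∈ Set.range g

/-- The vertex set is partitioned by `π` into parts labelled by colors such that every edge has the
dominant color `D`, except that the edges inside a part may also have the label of that part. -/
def IsDominantColor (c : V → V → K) (D : K) (π : V → K) : Prop :=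
  ∀ x y, x ≠ y → c x y = D ∨ (c x y = π x ∧ c x y = π y)

/-- The set of the colors of the edges at the vertex `x`. -/
def palette (c : V → V → K) (x : V) : Set K :=
  {d | ∃ y, y ≠ x ∧ c x y = d}

lemma exists_common_mem {ι : Type*} [Nonempty ι] (P : ι → Set K)
    (hmeet : ∀ i j, (P i ∩ P j).Nonempty)
    (htwo : ∀ i, ∀ a ∈ P i, ∀ b ∈ P i, ∀ d ∈ P i, a = b ∨ a = d ∨ b = d)
    (hcover : ∀ a b d, ∃ i, ∃ e ∈ P i, e ∉ [a, b, d]) : ∃ D, ∀ i, D ∈ P i := by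
  -- Otherwise three of the sets are `{a, b}`, `{b, d}`, `{a, d}`, and any set meeting all of these
  -- is contained in `{a, b, d}`.
  by_contra! hno
  obtain ⟨i⟩ := ‹Nonempty ι›
  obtain ⟨a, hai, -⟩ := hmeet i i
  obtain ⟨j, haj⟩ := hno a
  obtain ⟨b, hbi, hbj⟩ := hmeet i j
  obtain ⟨l, hbl⟩ := hno b
  obtain ⟨d, hdj, hdl⟩ := hmeet j l
  obtain ⟨s, e, hes, he⟩ := hcover a b d
  have hal : a ∈ P l := by
    obtain ⟨f, hfi, hfl⟩ := hmeet i l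
    grind
  obtain ⟨x, hxi, hxs⟩ := hmeet i s
  obtain ⟨y, hyj, hys⟩ := hmeet j s
  obtain ⟨z, hzl, hzs⟩ := hmeet l s
  grind

variable {c : V → V → K}

lemma RainbowPathFree.eq_or_eq (h : RainbowPathFree c) (x₁ x₂ x₃ x₄ x₅ : V) :
    (x₁ = x₂ ∨ x₁ = x₃ ∨ x₁ = x₄ ∨ x₁ = x₅ ∨ x₂ = x₃ ∨
      x₂ = x₄ ∨ x₂ = x₅ ∨ x₃ = x₄ ∨ x₃ = x₅ ∨ x₄ = x₅) ∨
    c x₁ x₂ = c x₂ x₃ ∨ c x₁ x₂ = c x₃ x₄ ∨ c x₁ x₂ = c x₄ x₅ ∨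
      c x₂ x₃ = c x₃ x₄ ∨ c x₂ x₃ = c x₄ x₅ ∨ c x₃ x₄ = c x₄ x₅ := by
  have hpath := h x₁ x₂ x₃ x₄ x₅
  simp only [List.nodup_cons, List.mem_cons, List.not_mem_nil, or_false, not_false_eq_true,
    List.nodup_nil, and_true] at hpath
  tauto

lemma IsRainbowChair.swap {v p q r s : V} (hC : IsRainbowChair c v p q r s) :
    IsRainbowChair c v q p r s := by
  grind [IsRainbowChair]

lemma palette_inter_nonempty [Nontrivial V] (hc : ∀ x y, c x y = c y x) (x y : V) :
    (palette c x ∩ palette c y).Nonempty := by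
  obtain rfl | hxy := eq_or_ne x y
  · obtain ⟨z, hz⟩ := exists_ne x
    exact ⟨c x z, ⟨z, hz, rfl⟩, z, hz, rfl⟩
  · exact ⟨c x y, ⟨y, hxy.symm, rfl⟩, x, hxy, hc y x⟩

section Symmetric
variable (hc : ∀ x y, c x y = c y x) (h : RainbowPathFree c)
include hc h

lemma IsRainbowChair.eq_of_notMem {v p q r s x : V} (hC : IsRainbowChair c v p q r s)
    (hx : x ∉ [v, p, q, r, s]) : c p x = c r s := by
  -- Each color below is forced because the listed path would otherwise be rainbow.
  obtain ⟨hv, hn⟩ := hC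
  by_contra hne
  have hpq : c p q = c v r ∨ c p q = c r s := by
    grind [h.eq_or_eq p q v r s, h.eq_or_eq q p v r s]
  have hqs : c q s = c v p ∨ c q s = c r s := by
    grind [h.eq_or_eq r s q v p, h.eq_or_eq p v r s q]
  have hpr : c p r = c v p ∨ c p r = c v q ∨ c p r = c r s := by
    grind [h.eq_or_eq q v p r s]
  have hpx : c p x = c v p ∨ c p x = c v r := by
    grind [h.eq_or_eq x p v r s]
  have hsx : c s x = c v r := by
    grind [h.eq_or_eq q v r s x, h.eq_or_eq p v r s x, h.eq_or_eq x p q v r,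
      h.eq_or_eq v q p x s, h.eq_or_eq s x p v q]
  have hpr' : c p r ≠ c v q := by
    grind [h.eq_or_eq x s r p v]
  have hqs' : c q s = c v p := by
    grind [h.eq_or_eq x s q v p]
  have hpr'' : c p r = c v p := by
    grind [h.eq_or_eq p r v q s]
  have hpq' : c p q = c r s := by
    grind [h.eq_or_eq v q p r s]
  have hpx' : c p x = c v r := by
    grind [h.eq_or_eq x p q v r]
  have hxr : c x r ≠ c v p := by
    grind [h.eq_or_eq v q p x r]
  grind [h.eq_or_eq q v p x r, h.eq_or_eq v q s r x, h.eq_or_eq s r x p v]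

lemma IsRainbowChair.nearlyMonochromatic {v p q r s : V} (hC : IsRainbowChair c v p q r s) :
    NearlyMonochromatic c := by
  classical
  refine ⟨{v, p, q, r, s}, c r s, card_le_five, fun x hx y hy hxy => ?_⟩
  have hpx := hC.eq_of_notMem hc h (x := x) (by simpa using hx)
  have hqx := hC.swap.eq_of_notMem hc h (x := x) (by grind)
  obtain ⟨hv, hn⟩ := hC
  grind [h.eq_or_eq y x p v q, h.eq_or_eq y x p v r, h.eq_or_eq y x q v r]

lemma nearlyMonochromatic_of_rainbow_star (hV : 5 < ENat.card V) {v a₁ a₂ a₃ a₄ : V}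
    (hv : [v, a₁, a₂, a₃, a₄].Nodup) (hn : [c v a₁, c v a₂, c v a₃, c v a₄].Nodup) :
    NearlyMonochromatic c := by
  classical
  by_contra hN
  have hchair (v p q r s : V) : ¬ IsRainbowChair c v p q r s :=
    fun hC => hN (hC.nearlyMonochromatic hc h)
  obtain ⟨x, hx⟩ : ∃ x, x ∉ ({v, a₁, a₂, a₃, a₄} : Finset V) :=
    exists_not_mem_of_card_lt_enatCard (lt_of_le_of_lt (mod_cast card_le_five) hV)
  have hax : c a₁ x = c v a₁ ∧ c a₂ x = c v a₂ ∧ c a₃ x = c v a₃ ∧ c a₄ x = c v a₄ := by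
    have hleaf {p q r s : V} (hv : [v, p, q, r, s].Nodup) (hx : x ∉ [v, p, q, r, s])
        (hn : [c v p, c v q, c v r, c v s].Nodup) : c p x = c v p := by
      grind [IsRainbowChair, hchair v q r p x, hchair v q s p x, hchair v r s p x]
    refine ⟨hleaf (q := a₂) (r := a₃) (s := a₄) ?_ ?_ ?_,
      hleaf (q := a₁) (r := a₃) (s := a₄) ?_ ?_ ?_,
      hleaf (q := a₁) (r := a₂) (s := a₄) ?_ ?_ ?_,
      hleaf (q := a₁) (r := a₂) (s := a₃) ?_ ?_ ?_⟩ <;> grind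
  have ha : c a₁ a₂ = c v a₃ ∨ c a₁ a₂ = c v a₄ := by
    grind [IsRainbowChair, hchair v a₃ a₄ a₁ a₂, hchair v a₃ a₄ a₂ a₁]
  grind [h.eq_or_eq v a₁ a₂ x a₃, h.eq_or_eq v a₁ a₂ x a₄]

lemma nearlyMonochromatic_of_rainbow_paw {a b d e : V} (hv : [a, b, d, e].Nodup)
    (hn : [c a b, c b d, c d a, c a e].Nodup) : NearlyMonochromatic c := by
  classical
  by_contra hN
  have hchair (v p q r s : V) : ¬ IsRainbowChair c v p q r s :=
    fun hC => hN (hC.nearlyMonochromatic hc h)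
  have hx {x : V} (hx : x ∉ ({a, b, d, e} : Finset V)) : c x b = c a e ∧ c x d = c a e := by
    constructor
    · grind [IsRainbowChair, h.eq_or_eq x b d a e, hchair a e d b x, hchair b x d a e]
    · grind [IsRainbowChair, h.eq_or_eq x d b a e, hchair a e b d x, hchair d x b a e]
  refine hN ⟨{a, b, d, e}, c a e, card_le_four.trans (by norm_num), fun x hxS y hyS hxy => ?_⟩
  grind [h.eq_or_eq y x b d a, h.eq_or_eq y x b a d, h.eq_or_eq y x d b a]

lemma nearlyMonochromatic_of_rainbow_claw_of_leaf_edge {x p q r s : V} (hx : [x, p, q, r].Nodup)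
    (hs : s ∉ [x, r]) (hn : [c x p, c x q, c x r, c r s].Nodup) : NearlyMonochromatic c := by
  by_cases hsp : s = p
  · exact nearlyMonochromatic_of_rainbow_paw hc h (a := x) (b := r) (d := p) (e := q)
      (by grind) (by grind)
  by_cases hsq : s = q
  · exact nearlyMonochromatic_of_rainbow_paw hc h (a := x) (b := r) (d := q) (e := p)
      (by grind) (by grind)
  · exact IsRainbowChair.nearlyMonochromatic hc h (v := x) (p := p) (q := q) (r := r) (s := s)
      ⟨by grind, hn⟩

lemma nearlyMonochromatic_of_rainbow_claw (hV : 5 < ENat.card V) {x p q r u v : V}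
    (hx : [x, p, q, r].Nodup) (hn : [c x p, c x q, c x r].Nodup) (huv : u ≠ v)
    (hcol : c u v ∉ [c x p, c x q, c x r]) : NearlyMonochromatic c := by
  by_cases hstar : ∃ a, a ≠ x ∧ c x a ∉ [c x p, c x q, c x r]
  · obtain ⟨a, hax, ha⟩ := hstar
    exact nearlyMonochromatic_of_rainbow_star hc h hV (v := x) (a₁ := p) (a₂ := q) (a₃ := r)
      (a₄ := a) (by grind) (by grind)
  push Not at hstar
  have hux : u ≠ x := by grind
  have hvx : v ≠ x := by grind
  have hxu : c x u = c x p ∨ c x u = c x q ∨ c x u = c x r := by grind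
  rcases hxu with hxu | hxu | hxu
  · exact nearlyMonochromatic_of_rainbow_claw_of_leaf_edge hc h (x := x) (p := q) (q := r) (r := u)
      (s := v) (by grind) (by grind) (by grind)
  · exact nearlyMonochromatic_of_rainbow_claw_of_leaf_edge hc h (x := x) (p := p) (q := r) (r := u)
      (s := v) (by grind) (by grind) (by grind)
  · exact nearlyMonochromatic_of_rainbow_claw_of_leaf_edge hc h (x := x) (p := p) (q := q) (r := u)
      (s := v) (by grind) (by grind) (by grind)

lemma RainbowPathFree.exists_isDominantColor (hV : 5 < ENat.card V)
    (hthree : ¬ UsesAtMostThreeColors c) (hN : ¬ NearlyMonochromatic c) :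
    ∃ (D : K) (π : V → K), IsDominantColor c D π := by
  have : Nontrivial V := (ENat.one_lt_card_iff_nontrivial V).1 (lt_trans (by norm_num) hV)
  have hcover (a b d : K) : ∃ u v, u ≠ v ∧ c u v ∉ [a, b, d] := by
    by_contra! hle
    exact hthree ⟨![d, b, a], fun u v huv => by simpa [eq_comm] using hle u v huv⟩
  have htwo (x : V) : ∀ a ∈ palette c x, ∀ b ∈ palette c x, ∀ d ∈ palette c x,
      a = b ∨ a = d ∨ b = d := by
    rintro _ ⟨p, hp, rfl⟩ _ ⟨q, hq, rfl⟩ _ ⟨r, hr, rfl⟩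
    by_contra hne
    obtain ⟨u, v, huv, hcol⟩ := hcover (c x p) (c x q) (c x r)
    exact hN (nearlyMonochromatic_of_rainbow_claw hc h hV (p := p) (q := q) (r := r) (by grind)
      (by grind) huv hcol)
  obtain ⟨D, hD⟩ := exists_common_mem (palette c) (palette_inter_nonempty hc) htwo fun a b d => by
    obtain ⟨u, v, huv, hcol⟩ := hcover a b d
    exact ⟨u, c u v, ⟨v, huv.symm, rfl⟩, hcol⟩
  have hπ (x : V) : ∃ e, ∀ d ∈ palette c x, d = D ∨ d = e := by
    by_cases hx : ∃ e ∈ palette c x, e ≠ D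
    · obtain ⟨e, he, heD⟩ := hx
      exact ⟨e, fun d hd => by grind [htwo x D (hD x) e he d hd]⟩
    · exact ⟨D, fun d hd => by grind⟩
  choose π hπ using hπ
  refine ⟨D, π, fun x y hxy => ?_⟩
  grind [hπ x (c x y) ⟨y, hxy.symm, rfl⟩, hπ y (c x y) ⟨x, hxy, hc y x⟩]

end Symmetric

end Structure

section Packing
variable {ι V W : Type*}

/-- The map `f` places vertex-disjoint copies of `H`, indexed by `ι`, into `G`. -/
structure IsPacking (G : SimpleGraph V) (H : SimpleGraph W) (f : ι × W → V) : Prop where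
  injective : Function.Injective f
  adj : ∀ i u v, H.Adj u v → G.Adj (f (i, u)) (f (i, v))

variable {G G₀ : SimpleGraph V} {H : SimpleGraph W}

lemma disjointCopies_isContained_iff {m : ℕ} :
    disjointCopies m H ⊑ G ↔ ∃ f : Fin m × W → V, IsPacking G H f := by
  constructor
  · rintro ⟨f⟩
    exact ⟨f, f.injective, fun i u v h => f.toHom.map_adj ⟨rfl, h⟩⟩
  · rintro ⟨f, hf⟩
    refine ⟨⟨⟨f, ?_⟩, hf.injective⟩⟩
    rintro ⟨i, u⟩ ⟨j, v⟩ ⟨rfl, huv⟩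
    exact hf.adj _ _ _ huv

lemma exists_isPacking_piecewise {s : Set ι} {f : ι × W → V} (hf : Function.Injective f)
    (hadj : ∀ i ∈ s, ∀ u v, H.Adj u v → G.Adj (f (i, u)) (f (i, v))) {g : ↥sᶜ × W → V}
    (hg : IsPacking G H g) (hdisj : ∀ i ∈ s, ∀ u x, f (i, u) ≠ g x) :
    ∃ F : ι × W → V, IsPacking G H F := by
  classical
  refine ⟨fun x => if h : x.1 ∈ s then f x else g (⟨x.1, h⟩, x.2), ?_, fun i u v huv => ?_⟩
  · rintro ⟨i, u⟩ ⟨j, v⟩ hij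
    by_cases hi : i ∈ s <;> by_cases hj : j ∈ s <;> simp only [hi, hj, dite_true, dite_false] at hij
    · exact hf hij
    · exact absurd hij (hdisj i hi u _)
    · exact absurd hij.symm (hdisj j hj v _)
    · simpa using hg.injective hij
  · by_cases hi : i ∈ s
    · simpa only [hi, dite_true] using hadj i hi u v huv
    · simpa only [hi, dite_false] using hg.adj ⟨i, hi⟩ u v huv

lemma card_mul_le_card [Fintype W] [DecidableEq V] {f : ι × W → V} (hf : Function.Injective f)
    (s : Finset ι) (X : Finset V) {q : ℕ} (hq : ∀ i ∈ s, q ≤ #{u | f (i, u) ∈ X}) :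
    #s * q ≤ #X := by
  calc #s * q ≤ ∑ i ∈ s, #{u | f (i, u) ∈ X} := by
        simpa using card_nsmul_le_sum s _ q hq
    _ = #(s.sigma fun i => ({u | f (i, u) ∈ X} : Finset W)) := (card_sigma _ _).symm
    _ ≤ #X := card_le_card_of_injOn (fun x => f (x.1, x.2)) (by intro x; simp)
        (by rintro ⟨i, u⟩ - ⟨j, v⟩ - h; simpa using hf h)

lemma card_mul_le_card_sdiff [Fintype ι] [Fintype W] [DecidableEq ι] [DecidableEq V]
    {f : ι × W → V} (s : Finset ι) (X : Finset V) {q : ℕ} (hcard : Fintype.card ι * q ≤ #X)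
    (hq : ∀ i, #{u | f (i, u) ∈ X} ≤ q) : #sᶜ * q ≤ #(X \ (s ×ˢ univ).image f) := by
  have hused : #(X ∩ (s ×ˢ univ).image f) ≤ #s * q := by
    calc #(X ∩ (s ×ˢ univ).image f)
        ≤ #(s.biUnion fun i => ({u | f (i, u) ∈ X} : Finset W).image fun u => f (i, u)) := by
          refine card_le_card fun x hx => ?_
          simp only [mem_inter, mem_image, mem_product, mem_univ, and_true, mem_biUnion, mem_filter,
            true_and, Prod.exists] at hx ⊢
          grind
      _ ≤ #s * q := card_biUnion_le_card_mul _ _ _ fun i _ => card_image_le.trans (hq i)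
  have hsplit := card_inter_add_card_sdiff X ((s ×ˢ univ).image f)
  rw [← card_add_card_compl s, add_mul] at hcard
  omega

lemma exists_isPacking_of_coloring [Fintype ι] [Finite W] {κ : Type*} (τ : H.Coloring κ)
    (S : κ → Finset V) (hS : ∀ j j', j ≠ j' → G.IsCompleteBetween (S j) (S j'))
    (hcard : ∀ j, Fintype.card ι * (τ.colorClass j).ncard ≤ #(S j)) :
    ∃ f : ι × W → V, IsPacking G H f ∧ ∀ i w, f (i, w) ∈ S (τ w) := by
  have hplace (j : κ) : ∃ e : ι × τ.colorClass j → S j, Function.Injective e := by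
    have := Fintype.ofFinite (τ.colorClass j)
    obtain ⟨e⟩ := Function.Embedding.nonempty_of_card_le (α := ι × τ.colorClass j) (β := S j)
      (by
        rw [Fintype.card_prod, ← Nat.card_eq_fintype_card (α := τ.colorClass j),
          Nat.card_coe_set_eq, Fintype.card_coe]
        exact hcard j)
    exact ⟨e, e.injective⟩
  choose e he using hplace
  have hmem (i : ι) (w : W) : (e (τ w) (i, ⟨w, rfl⟩) : V) ∈ S (τ w) := Subtype.coe_prop _
  refine ⟨fun x => e (τ x.2) (x.1, ⟨x.2, rfl⟩), ⟨?_, fun i u v huv =>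
    hS _ _ (τ.valid huv) (hmem i u) (hmem i v)⟩, hmem⟩
  rintro ⟨i, u⟩ ⟨i', u'⟩ h
  have hinj (j j' : κ) (hu : τ u = j) (hu' : τ u' = j') (hj : j = j')
      (h : (e j (i, ⟨u, hu⟩) : V) = e j' (i', ⟨u', hu'⟩)) : (i, u) = (i', u') := by
    subst hj
    simpa [Subtype.ext_iff] using he j (Subtype.ext h)
  refine hinj _ _ rfl rfl ?_ h
  by_contra hne
  exact (hS _ _ hne (hmem i u) (hmem i' u')).ne h

/-- The graph `H` is tripartite with color classes of sizes `a`, `a` and `1`, and has independence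
number `a`. The cases of interest are `K₃` with `a = 1` and `C₅` with `a = 2`. -/
structure IsBalancedTripartite (H : SimpleGraph W) (a : ℕ) : Prop where
  exists_coloring : ∃ τ : H.Coloring (Fin 3), ∀ j, (τ.colorClass j).ncard = ![a, a, 1] j
  card_le_of_isIndepSet : ∀ s : Finset W, H.IsIndepSet s → #s ≤ a

namespace IsBalancedTripartite

variable {a : ℕ} (hH : IsBalancedTripartite H a)
include hH

lemma one_le : 1 ≤ a := by
  obtain ⟨τ, hτ⟩ := hH.exists_coloring
  obtain ⟨w, -⟩ : (τ.colorClass 2).Nonempty := Set.nonempty_of_ncard_ne_zero (by simp [hτ])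
  simpa using hH.card_le_of_isIndepSet {w} (by simp)

lemma card_eq [Fintype W] : Fintype.card W = 2 * a + 1 := by
  obtain ⟨τ, hτ⟩ := hH.exists_coloring
  have hsum : Fintype.card W = ∑ j, (τ.colorClass j).ncard := by
    simpa [Set.ncard_eq_toFinset_card', Coloring.colorClass] using
      card_eq_sum_card_fiberwise (s := (univ : Finset W)) (t := univ) (f := τ) (by simp)
  simp only [hsum, hτ, Fin.sum_univ_three, Matrix.cons_val]
  ring

lemma exists_adj [Finite W] (u : W) : ∃ v, H.Adj u v := by
  classical
  have := Fintype.ofFinite W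
  by_contra! hu
  obtain ⟨τ, hτ⟩ := hH.exists_coloring
  obtain ⟨j, hj, huj⟩ : ∃ j, (τ.colorClass j).ncard = a ∧ u ∉ τ.colorClass j := by
    by_cases h0 : u ∈ τ.colorClass 0
    · exact ⟨1, by simp [hτ], by simp_all [Coloring.colorClass]⟩
    · exact ⟨0, by simp [hτ], h0⟩
  have hindep : H.IsIndepSet (insert u (τ.colorClass j)) :=
    (τ.isIndepSet_colorClass j).insert fun v _ _ => ⟨hu v, fun h => hu v h.symm⟩
  have hle := hH.card_le_of_isIndepSet (insert u (τ.colorClass j)).toFinset (by simpa using hindep)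
  rw [← Set.ncard_eq_toFinset_card', Set.ncard_insert_of_notMem huj, hj] at hle
  omega

lemma exists_isPacking [Finite W] [Fintype ι] {A B C : Finset V}
    (hAB : G.IsCompleteBetween A B) (hAC : G.IsCompleteBetween A C)
    (hBC : G.IsCompleteBetween B C) (hA : Fintype.card ι * a ≤ #A) (hB : Fintype.card ι * a ≤ #B)
    (hC : Fintype.card ι ≤ #C) :
    ∃ f : ι × W → V, IsPacking G H f ∧ ∀ x, f x ∈ A ∨ f x ∈ B ∨ f x ∈ C := by
  obtain ⟨τ, hτ⟩ := hH.exists_coloring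
  obtain ⟨f, hf, hmem⟩ := exists_isPacking_of_coloring (ι := ι) (G := G) τ ![A, B, C] (by
    intro j j' hj
    fin_cases j <;> fin_cases j' <;> first
      | exact absurd rfl hj
      | assumption
      | exact (isCompleteBetween_comm G).1 (by assumption)) (by
    intro j
    fin_cases j <;> simpa [hτ])
  refine ⟨f, hf, fun x => ?_⟩
  have hx := hmem x.1 x.2
  generalize τ x.2 = j at hx
  fin_cases j <;> simp_all

lemma card_le_of_isContained [Finite W] {m : ℕ} {X : Finset V} (hX : G.support ⊆ X)
    (h : disjointCopies m H ⊑ G) : m * (2 * a + 1) ≤ #X := by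
  classical
  have := Fintype.ofFinite W
  obtain ⟨f, hf⟩ := disjointCopies_isContained_iff.1 h
  have hmem (i : Fin m) (u : W) : f (i, u) ∈ X := by
    obtain ⟨v, huv⟩ := hH.exists_adj u
    exact hX ⟨_, hf.adj i u v huv⟩
  simpa using card_mul_le_card (q := 2 * a + 1) hf.injective univ X fun i _ => by
    simp [hmem, hH.card_eq]

lemma exists_isPacking_of_replace [Finite W] [Finite ι] {A B R : Finset V} {q r : ℕ}
    (hAB : G.IsCompleteBetween A B) (hAR : G.IsCompleteBetween A R)
    (hBR : G.IsCompleteBetween B R)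
    (hG : ∀ x y, G₀.Adj x y → G.Adj x y ∨ x ∈ R) (haq : a ≤ q) (har : a ≤ r)
    (hA : Nat.card ι * q ≤ #A) (hB : Nat.card ι * r ≤ #B) {f : ι × W → V} (hf : IsPacking G₀ H f)
    (hfA : ∀ i, {u | f (i, u) ∈ A}.ncard ≤ q) (hfB : ∀ i, {u | f (i, u) ∈ B}.ncard ≤ r) :
    ∃ g : ι × W → V, IsPacking G H g := by
  classical
  have := Fintype.ofFinite W
  have := Fintype.ofFinite ι
  -- A copy of `H` not contained in `G` uses a vertex of `R`, so that outside the copies in `G`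
  -- enough of `A`, `B` and `R` is left to replace the others.
  let s : Finset ι := {i | ∀ u v, H.Adj u v → G.Adj (f (i, u)) (f (i, v))}
  let U : Finset V := (s ×ˢ univ).image f
  have hbad : Fintype.card ↥(s : Set ι)ᶜ = #sᶜ := by
    simp [compl_filter, s]
  have hcompl {X Y : Finset V} (h : G.IsCompleteBetween X Y) :
      G.IsCompleteBetween ↑(X \ U) ↑(Y \ U) :=
    fun x hx y hy => h (mem_sdiff.1 hx).1 (mem_sdiff.1 hy).1
  have hlarge {X : Finset V} {q : ℕ} (haq : a ≤ q) (hX : Nat.card ι * q ≤ #X)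
      (hfX : ∀ i, {u | f (i, u) ∈ X}.ncard ≤ q) : Fintype.card ↥(s : Set ι)ᶜ * a ≤ #(X \ U) := by
    rw [hbad]
    exact (Nat.mul_le_mul_left _ haq).trans
      (card_mul_le_card_sdiff s X (by simpa using hX)
        (by simpa [Set.ncard_eq_toFinset_card'] using hfX))
  have hR : Fintype.card ↥(s : Set ι)ᶜ ≤ #(R \ U) := by
    rw [hbad, ← mul_one #sᶜ]
    refine card_mul_le_card hf.injective sᶜ _ fun i hi => card_pos.2 ?_
    obtain ⟨u, v, huv, hnot⟩ : ∃ u v, H.Adj u v ∧ ¬ G.Adj (f (i, u)) (f (i, v)) := by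
      simpa [s] using hi
    have huR : f (i, u) ∈ R := (hG _ _ (hf.adj i u v huv)).resolve_left hnot
    have huU : f (i, u) ∉ U := by
      have := mem_compl.1 hi
      simp only [U, hf.injective.mem_finset_image, mem_product, this, false_and, not_false_eq_true]
    exact ⟨u, by simp [huR, huU]⟩
  obtain ⟨g, hg, hmem⟩ := hH.exists_isPacking (hcompl hAB) (hcompl hAR) (hcompl hBR)
    (hlarge haq hA hfA) (hlarge har hB hfB) hR
  refine exists_isPacking_piecewise hf.injective (fun i hi => by simpa [s] using hi) hg
    fun i hi u x hux => ?_
  have huU : f (i, u) ∈ U := mem_image_of_mem f (by simpa using hi)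
  simpa [← hux, huU] using hmem x

end IsBalancedTripartite
end Packing

section Labeling
variable {V W K : Type*}

/-- The edge labeling of the complete graph on `V` given by a symmetric function of two vertices. -/
def labeling (c : V → V → K) (hc : ∀ x y, c x y = c y x) : TopEdgeLabeling V K :=
  EdgeLabeling.mk (fun x y _ => c x y) fun x y _ => hc y x

lemma labelGraph_labeling_adj {c : V → V → K} {hc : ∀ x y, c x y = c y x} {d : K} {x y : V} :
    ((labeling c hc).labelGraph d).Adj x y ↔ x ≠ y ∧ c x y = d := by
  simp only [TopEdgeLabeling.labelGraph_adj, labeling, EdgeLabeling.get_mk, exists_prop]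

lemma exists_eq_labeling [Nonempty K] (C : TopEdgeLabeling V K) :
    ∃ (c : V → V → K) (hc : ∀ x y, c x y = c y x), C = labeling c hc := by
  classical
  obtain ⟨o⟩ := ‹Nonempty K›
  have hc (x y : V) : (if h : x = y then o else C.get x y h) =
      if h : y = x then o else C.get y x h := by
    by_cases h : x = y
    · simp only [h, dite_true]
    · simpa only [h, Ne.symm h, dite_false] using EdgeLabeling.get_comm y x h
  refine ⟨_, hc, EdgeLabeling.ext_get fun x y h => ?_⟩
  rw [labeling, EdgeLabeling.get_mk, dif_neg h]

lemma isContained_or_isContained_or_isContained_compl {H : SimpleGraph W}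
    (hR : ∀ C : TopEdgeLabeling V (Fin 3), HasMonochromaticCopy C H) (G₁ G₂ : SimpleGraph V) :
    H ⊑ G₁ ∨ H ⊑ G₂ ∨ H ⊑ (G₁ ⊔ G₂)ᶜ := by
  classical
  let c (x y : V) : Fin 3 := if G₁.Adj x y then 0 else if G₂.Adj x y then 1 else 2
  obtain ⟨d, hd⟩ := hR (labeling c fun x y => by simp only [c, G₁.adj_comm, G₂.adj_comm])
  have hle {G : SimpleGraph V} (h : ∀ x y, x ≠ y → c x y = d → G.Adj x y) : H ⊑ G :=
    hd.mono_right fun x y hxy => (labelGraph_labeling_adj.1 hxy).elim (h x y)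
  fin_cases d
  · exact .inl (hle fun x y _ h => by grind)
  · exact .inr (.inl (hle fun x y _ h => by grind))
  · exact .inr (.inr (hle fun x y hne h => by simp only [compl_adj, sup_adj]; grind))

end Labeling

section Sums
variable {κ : Type*} {s : κ → ℕ}

lemma exists_subset_sum_mem_Icc {L M : ℕ} (hLM : 2 * L ≤ M + 1) (T : Finset κ)
    (hs : ∀ j ∈ T, s j ≤ M) (hT : L ≤ ∑ j ∈ T, s j) : ∃ T' ⊆ T, ∑ j ∈ T', s j ∈ Set.Icc L M := by
  classical
  induction T using Finset.induction_on with
  | empty => exact ⟨∅, Subset.rfl, hT, by simp⟩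
  | insert j T hj ih =>
    by_cases hT' : L ≤ ∑ j ∈ T, s j
    · obtain ⟨T', hsub, hT'⟩ := ih (fun i hi => hs i (mem_insert_of_mem hi)) hT'
      exact ⟨T', hsub.trans (subset_insert j T), hT'⟩
    by_cases hjL : L ≤ s j
    · exact ⟨{j}, by simp, by simpa using ⟨hjL, hs j (mem_insert_self j T)⟩⟩
    · refine ⟨insert j T, Subset.rfl, hT, ?_⟩
      rw [sum_insert hj]
      omega

lemma exists_large_or_exists_three_sums [DecidableEq κ] {L m : ℕ} (P : Finset κ)
    (hP : 4 * L + 3 * m ≤ ∑ j ∈ P, s j + 2) :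
    (∃ i, ∑ j ∈ P.erase i, s j < 2 * L + m) ∨
    (∃ i j, i ≠ j ∧ 2 * L + m ≤ s i ∧ L ≤ s j) ∨
    ∃ T₁ T₂ T₃ : Finset κ, Disjoint T₁ T₂ ∧ Disjoint T₁ T₃ ∧ Disjoint T₂ T₃ ∧
      L ≤ ∑ j ∈ T₁, s j ∧ L ≤ ∑ j ∈ T₂, s j ∧ m ≤ ∑ j ∈ T₃, s j := by
  by_contra! hno
  obtain ⟨hone, htwo, hthree⟩ := hno
  obtain ⟨i, hi⟩ | hsmall := exists_or_forall_not fun i => 2 * L + m ≤ s i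
  · obtain ⟨T, hT, hTL, hTM⟩ := exists_subset_sum_mem_Icc (s := s) (L := L) (M := 2 * L - 1)
      (by omega) (P.erase i) (fun j hj => by have := htwo i j (ne_of_mem_erase hj).symm hi; omega)
      (by have := hone i; omega)
    have hiT : Disjoint {i} T := by
      simpa using fun h => notMem_erase i P (hT h)
    refine absurd (hthree {i} T (P.erase i \ T) hiT (by simp) disjoint_sdiff
      (by rw [sum_singleton]; omega) hTL) ?_
    have := sum_sdiff hT (f := s)
    grind [hone i]
  · obtain ⟨T₁, hT₁, hL₁, hM₁⟩ := exists_subset_sum_mem_Icc (s := s) (L := L) (M := 2 * L + m - 1)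
      (by omega) P (fun j _ => by have := hsmall j; omega) (by omega)
    have hrest := sum_sdiff hT₁ (f := s)
    obtain ⟨T₂, hT₂, hL₂, hM₂⟩ := exists_subset_sum_mem_Icc (s := s) (L := L) (M := 2 * L + m - 1)
      (by omega) (P \ T₁) (fun j _ => by have := hsmall j; omega) (by omega)
    have := sum_sdiff hT₂ (f := s)
    refine absurd (hthree T₁ T₂ ((P \ T₁) \ T₂) (disjoint_sdiff.mono_right hT₂)
      (disjoint_sdiff.mono_right sdiff_subset) disjoint_sdiff hL₁ hL₂) ?_
    grind

end Sums

section DominantColor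
variable {V W K : Type*} {H : SimpleGraph W} {a m : ℕ}

/-- The graph on `V` in which two vertices are adjacent when both lie in `S`. -/
def completeOn (S : Set V) : SimpleGraph V where
  Adj x y := x ≠ y ∧ x ∈ S ∧ y ∈ S
  symm := ⟨fun _ _ h => ⟨h.1.symm, h.2.symm⟩⟩
  loopless := ⟨fun _ h => h.1 rfl⟩

lemma completeOn_adj {S : Set V} {x y : V} : (completeOn S).Adj x y ↔ x ≠ y ∧ x ∈ S ∧ y ∈ S :=
  Iff.rfl

lemma IsBalancedTripartite.isContained_or_isContained_compl_completeOn [Finite W]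
    (hH : IsBalancedTripartite H a)
    (hR : ∀ C : TopEdgeLabeling V (Fin 3), HasMonochromaticCopy C (disjointCopies m H))
    (G : SimpleGraph V) {S : Finset V} (hS : #S < m * (2 * a + 1)) :
    disjointCopies m H ⊑ G ∨ disjointCopies m H ⊑ (G ⊔ completeOn S)ᶜ := by
  rcases isContained_or_isContained_or_isContained_compl hR G (completeOn S) with h | h | h
  · exact .inl h
  · refine absurd (hH.card_le_of_isContained ?_ h) hS.not_ge
    rintro x ⟨y, hxy⟩
    exact hxy.2.1
  · exact .inr h

lemma IsPacking.ncard_le_of_isIndepSet {ι : Type*} [Finite W] {G : SimpleGraph V} {X : Set V}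
    {f : ι × W → V} (hf : IsPacking G H f) (hH : IsBalancedTripartite H a) (hX : G.IsIndepSet X)
    (i : ι) : {u | f (i, u) ∈ X}.ncard ≤ a := by
  classical
  have := Fintype.ofFinite W
  rw [Set.ncard_eq_toFinset_card']
  refine hH.card_le_of_isIndepSet _ fun u hu v hv huv hadj => ?_
  exact hX (by simpa using hu) (by simpa using hv)
    (fun h => huv (by simpa using hf.injective h)) (hf.adj i u v hadj)

variable {c : V → V → K} {hc : ∀ x y, c x y = c y x} {D : K} {π : V → K}
  (hdom : IsDominantColor c D π)
include hdom

lemma IsDominantColor.isCompleteBetween {A B : Set V} (h : ∀ x ∈ A, ∀ y ∈ B, π x ≠ π y) :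
    ((labeling c hc).labelGraph D).IsCompleteBetween A B := by
  intro x hx y hy
  have hne := h x hx y hy
  refine labelGraph_labeling_adj.2 ⟨fun hxy => hne (congrArg π hxy), ?_⟩
  exact (hdom x y fun hxy => hne (congrArg π hxy)).resolve_right fun h => hne (h.1.symm.trans h.2)

variable [Fintype V] [DecidableEq K] [Finite W] (hH : IsBalancedTripartite H a)
include hH

lemma IsDominantColor.isContained_of_two_large {i j : K} {r : ℕ} {G₀ : SimpleGraph V} (hij : i ≠ j)
    (hG₀ : ∀ x y, G₀.Adj x y → c x y = D ∨ (π x ≠ i ∧ π x ≠ j)) (har : a ≤ r)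
    (hi : m * (2 * a + 1) ≤ #{x | π x = i}) (hj : m * r ≤ #{x | π x = j})
    (hcopy : disjointCopies m H ⊑ G₀)
    (hfj : ∀ f : Fin m × W → V, IsPacking G₀ H f → ∀ t, {u | π (f (t, u)) = j}.ncard ≤ r) :
    disjointCopies m H ⊑ (labeling c hc).labelGraph D := by
  classical
  have := Fintype.ofFinite W
  obtain ⟨f, hf⟩ := disjointCopies_isContained_iff.1 hcopy
  refine disjointCopies_isContained_iff.2 (hH.exists_isPacking_of_replace
    (A := {x | π x = i}) (B := {x | π x = j}) (R := {x | π x ≠ i ∧ π x ≠ j})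
    (q := 2 * a + 1) (r := r) (G₀ := G₀) (f := f)
    (hdom.isCompleteBetween ?_) (hdom.isCompleteBetween ?_) (hdom.isCompleteBetween ?_)
    ?_ (by omega) har (by simpa using hi) (by simpa using hj) hf (fun t => ?_)
    (by simpa using hfj f hf))
  · grind
  · grind
  · grind
  · intro x y hxy
    simpa only [labelGraph_labeling_adj, hxy.ne, ne_eq, not_false_eq_true, true_and, mem_filter,
      mem_univ] using hG₀ x y hxy
  · rw [← hH.card_eq, ← Nat.card_eq_fintype_card]
    exact Set.ncard_le_card _

variable (hR : ∀ C : TopEdgeLabeling V (Fin 3), HasMonochromaticCopy C (disjointCopies m H))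
include hR

lemma IsDominantColor.exists_isContained_of_small_compl {i : K}
    (hi : #{x | π x ≠ i} < m * (2 * a + 1)) :
    ∃ d, disjointCopies m H ⊑ (labeling c hc).labelGraph d := by
  obtain h | h := hH.isContained_or_isContained_compl_completeOn hR
    ((labeling c hc).labelGraph i) hi
  · exact ⟨i, h⟩
  · refine ⟨D, h.mono_right fun x y hxy => labelGraph_labeling_adj.2 ⟨hxy.ne, ?_⟩⟩
    have := hdom x y hxy.ne
    simp only [compl_adj, sup_adj, labelGraph_labeling_adj, completeOn_adj, coe_filter,
      mem_univ, true_and, Set.mem_ofPred_eq] at hxy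
    grind

lemma IsDominantColor.exists_isContained_of_two_large {i j : K} (hij : i ≠ j)
    (hi : m * (2 * a + 1) ≤ #{x | π x = i}) (hj : m * a ≤ #{x | π x = j}) :
    ∃ d, disjointCopies m H ⊑ (labeling c hc).labelGraph d := by
  have := Fintype.ofFinite W
  obtain hj' | hj' := lt_or_ge #{x | π x = j} (m * (2 * a + 1))
  · obtain h | h := hH.isContained_or_isContained_compl_completeOn hR
      ((labeling c hc).labelGraph i) hj'
    · exact ⟨i, h⟩
    refine ⟨D, hdom.isContained_of_two_large hH hij (fun x y hxy => ?_) le_rfl hi hj h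
      fun f hf => hf.ncard_le_of_isIndepSet hH (X := {x | π x = j}) fun x hx y hy hne hxy => ?_⟩
    · have := hdom x y hxy.ne
      simp only [compl_adj, sup_adj, labelGraph_labeling_adj, completeOn_adj, coe_filter,
        mem_univ, true_and, Set.mem_ofPred_eq] at hxy
      grind
    · simp only [compl_adj, sup_adj, completeOn_adj, coe_filter, mem_univ, true_and] at hxy
      exact hxy.2 (.inr ⟨hne, hx, hy⟩)
  · obtain h | h | h := isContained_or_isContained_or_isContained_compl hR
      ((labeling c hc).labelGraph i) ((labeling c hc).labelGraph j)
    · exact ⟨i, h⟩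
    · exact ⟨j, h⟩
    refine ⟨D, hdom.isContained_of_two_large hH hij (fun x y hxy => ?_) (by omega) hi hj' h
      fun f _ t => ?_⟩
    · have := hdom x y hxy.ne
      simp only [compl_adj, sup_adj, labelGraph_labeling_adj] at hxy
      grind
    · rw [← hH.card_eq, ← Nat.card_eq_fintype_card]
      exact Set.ncard_le_card _

omit [DecidableEq K] in
theorem IsDominantColor.exists_isContained (hV : m * (4 * a + 3) ≤ Fintype.card V + 2) :
    ∃ d, disjointCopies m H ⊑ (labeling c hc).labelGraph d := by
  classical
  have hsum (T : Finset K) : ∑ j ∈ T, #{x | π x = j} = #{x | π x ∈ T} := by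
    rw [card_eq_sum_card_fiberwise (f := π) (t := T) fun x hx => by simpa using hx]
    exact sum_congr rfl fun j hj => congrArg card (by grind)
  have hcard : ∑ j ∈ univ.image π, #{x | π x = j} = Fintype.card V := by simp [hsum]
  obtain ⟨i, hi⟩ | ⟨i, j, hij, hi, hj⟩ | ⟨T₁, T₂, T₃, h₁₂, h₁₃, h₂₃, h₁, h₂, h₃⟩ :=
    exists_large_or_exists_three_sums (s := fun j => #{x | π x = j}) (L := m * a) (m := m)
      (univ.image π) (by linarith)
  · refine hdom.exists_isContained_of_small_compl hH hR (i := i) ?_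
    calc #{x | π x ≠ i} = ∑ j ∈ (univ.image π).erase i, #{x | π x = j} := by simp [hsum]
      _ < m * (2 * a + 1) := by linarith
  · exact hdom.exists_isContained_of_two_large hH hR hij (by linarith) hj
  · rw [hsum] at h₁ h₂ h₃
    have hcomplete {S T : Finset K} (h : Disjoint S T) :
        ((labeling c hc).labelGraph D).IsCompleteBetween
          ↑({x | π x ∈ S} : Finset V) ↑({x | π x ∈ T} : Finset V) :=
      hdom.isCompleteBetween fun x hx y hy =>
        disjoint_iff_ne.1 h _ (by simpa using hx) _ (by simpa using hy)
    obtain ⟨f, hf, -⟩ := hH.exists_isPacking (ι := Fin m) (hcomplete h₁₂) (hcomplete h₁₃)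
      (hcomplete h₂₃) (by simpa using h₁) (by simpa using h₂) (by simpa using h₃)
    exact ⟨D, disjointCopies_isContained_iff.2 ⟨f, hf⟩⟩

end DominantColor

section LowerBound
variable {V W : Type*} {G : SimpleGraph V} {H : SimpleGraph W} {a m : ℕ}

lemma IsBalancedTripartite.card_le_of_isVertexCover [Finite W] (hH : IsBalancedTripartite H a)
    {X : Finset V} (hX : G.IsVertexCover X) (h : disjointCopies m H ⊑ G) :
    m * (a + 1) ≤ #X := by
  classical
  have := Fintype.ofFinite W
  obtain ⟨f, hf⟩ := disjointCopies_isContained_iff.1 h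
  have hindep : G.IsIndepSet (X : Set V)ᶜ := isIndepSet_compl_iff_isVertexCover.2 hX
  simpa using card_mul_le_card (q := a + 1) hf.injective univ X fun i _ => by
    have hout := hf.ncard_le_of_isIndepSet hH hindep i
    have hsplit := card_filter_add_card_filter_not (s := (univ : Finset W)) fun u => f (i, u) ∈ X
    rw [card_univ, hH.card_eq] at hsplit
    simp only [Set.mem_compl_iff, mem_coe, Set.ncard_eq_toFinset_card', Set.toFinset_ofPred] at hout
    omega

lemma exists_card_fiber_le {κ : Type*} [Fintype V] [Fintype κ] [DecidableEq κ] (s : κ → ℕ)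
    (hV : Fintype.card V ≤ ∑ j, s j) : ∃ l : V → κ, ∀ j, #{x | l x = j} ≤ s j := by
  obtain ⟨e⟩ := Function.Embedding.nonempty_of_card_le (α := V) (β := Σ j, Fin (s j)) (by simpa)
  refine ⟨fun x => (e x).1, fun j => ?_⟩
  calc #{x | (e x).1 = j} ≤ #(({j} : Finset κ).sigma fun j => (univ : Finset (Fin (s j)))) :=
        card_le_card_of_injOn e (by intro x; simp) e.injective.injOn
    _ = s j := by simp

theorem IsBalancedTripartite.le_card_add_two [Finite W] [Fintype V]
    (hH : IsBalancedTripartite H a)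
    (hR : ∀ C : TopEdgeLabeling V (Fin 3), HasMonochromaticCopy C (disjointCopies m H)) :
    m * (4 * a + 3) ≤ Fintype.card V + 2 := by
  by_contra! hV
  have hm : 1 ≤ m := Nat.pos_of_ne_zero (by rintro rfl; omega)
  have hlarge : 1 ≤ m * (2 * a + 1) := by nlinarith
  have hsmall : 1 ≤ m * (a + 1) := by nlinarith
  obtain ⟨l, hl⟩ := exists_card_fiber_le (V := V)
    ![m * (2 * a + 1) - 1, m * (a + 1) - 1, m * (a + 1) - 1] (by
      simp only [Fin.sum_univ_three, Matrix.cons_val]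
      zify [hlarge, hsmall] at hV ⊢
      linarith)
  -- Color `0` is confined to level `0`, and every edge of color `d ≠ 0` has an end in level `d`.
  let c (x y : V) : Fin 3 := max (l x) (l y)
  have hc (x y : V) : c x y = c y x := max_comm _ _
  obtain ⟨d, hd⟩ := hR (labeling c hc)
  have hcover {x y : V} (h : ((labeling c hc).labelGraph d).Adj x y) : max (l x) (l y) = d :=
    (labelGraph_labeling_adj.1 h).2
  obtain rfl | hd0 := eq_or_ne d 0
  · have hle := hH.card_le_of_isContained (X := {x | l x = 0}) (by
      rintro x ⟨y, hxy⟩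
      simpa using (le_max_left (l x) (l y)).trans_eq (hcover hxy)) hd
    have : #{x | l x = 0} ≤ m * (2 * a + 1) - 1 := hl 0
    omega
  · have hle := hH.card_le_of_isVertexCover (X := {x | l x = d}) (fun x y hxy => by
      simpa using (max_choice (l x) (l y)).imp (·.symm.trans (hcover hxy))
        (·.symm.trans (hcover hxy))) hd
    have : #{x | l x = d} ≤ m * (a + 1) - 1 := (hl d).trans_eq (by
      fin_cases d
      · exact absurd rfl hd0
      · rfl
      · rfl)
    omega

end LowerBound

section Ramsey
variable {V W K : Type*}

lemma isContained_of_isClique [Finite W] {G : SimpleGraph V} {S : Finset V}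
    (hS : G.IsClique S) (H : SimpleGraph W) (hcard : Nat.card W ≤ #S) : H ⊑ G := by
  have := Fintype.ofFinite W
  obtain ⟨e⟩ := Function.Embedding.nonempty_of_card_le (α := W) (β := S) (by simpa using hcard)
  exact ⟨⟨⟨fun w => e w, fun {u v} h => hS (e u).2 (e v).2 (by simpa using h.ne)⟩,
    Subtype.val_injective.comp e.injective⟩⟩

lemma exists_isNClique [Finite K] (t : K → ℕ) :
    ∃ n, ∀ (V : Type*) (G : K → SimpleGraph V), (∀ x y, x ≠ y → ∃ i, (G i).Adj x y) →
      ∀ S : Finset V, n ≤ #S → ∃ i, ∃ T ⊆ S, (G i).IsNClique (t i) T := by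
  classical
  have := Fintype.ofFinite K
  induction hN : ∑ i, t i using Nat.strong_induction_on generalizing t with
  | _ N ih =>
  obtain ⟨i, hi⟩ | hpos := exists_or_forall_not fun i => t i = 0
  · exact ⟨0, fun V G _ S _ => ⟨i, ∅, empty_subset S, by simp [hi]⟩⟩
  have hlt (i : K) : ∑ j, Function.update t i (t i - 1) j < N := by
    rw [← hN]
    exact sum_lt_sum (fun j _ => by by_cases h : j = i <;> simp_all) ⟨i, mem_univ i, by
      simpa using Nat.sub_lt (Nat.pos_of_ne_zero (hpos i)) one_pos⟩
  choose n hn using fun i => ih _ (hlt i) _ rfl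
  refine ⟨2 + ∑ i, n i, fun V G hG S hS => ?_⟩
  obtain ⟨v, hv⟩ : S.Nonempty := card_pos.1 (by omega)
  obtain ⟨i, -, hi⟩ : ∃ i ∈ univ, n i < #{x ∈ S | (G i).Adj v x} := by
    refine exists_lt_of_sum_lt ?_
    calc ∑ i, n i < #(S.erase v) := by rw [card_erase_of_mem hv]; omega
      _ ≤ #(univ.biUnion fun i => {x ∈ S | (G i).Adj v x}) := card_le_card fun x hx => by
        simpa [mem_of_mem_erase hx] using hG v x (ne_of_mem_erase hx).symm
      _ ≤ ∑ i, #{x ∈ S | (G i).Adj v x} := card_biUnion_le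
  obtain ⟨j, T, hT, hclique⟩ := hn i V G hG _ hi.le
  obtain rfl | hij := eq_or_ne j i
  · refine ⟨j, insert v T, insert_subset hv (hT.trans (filter_subset _ _)), ?_⟩
    have := hclique.insert fun x hx => (mem_filter.1 (hT hx)).2
    simpa [Nat.sub_add_cancel (Nat.pos_of_ne_zero (hpos j))] using this
  · exact ⟨j, T, hT.trans (filter_subset _ _), by simpa [hij] using hclique⟩

theorem ramseySet_nonempty [Finite W] (k : ℕ) (H : SimpleGraph W) : (ramseySet k H).Nonempty := by
  obtain ⟨n, hn⟩ := exists_isNClique fun _ : Fin k => Nat.card W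
  refine ⟨n, fun C => ?_⟩
  obtain ⟨i, T, -, hT⟩ := hn (Fin n) C.labelGraph (fun x y hxy => ⟨C.get x y hxy, by simp [hxy]⟩)
    univ (by simp)
  exact ⟨i, isContained_of_isClique hT.isClique H hT.card_eq.ge⟩

end Ramsey

section Rainbow
variable {V W K K' : Type*}

lemma HasMonochromaticCopy.compRight {C : TopEdgeLabeling V K} {H : SimpleGraph W}
    (h : HasMonochromaticCopy C H) (g : K → K') : HasMonochromaticCopy (C.compRight g) H := by
  obtain ⟨d, hd⟩ := h
  refine ⟨g d, hd.mono_right fun x y hxy => ?_⟩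
  obtain ⟨hne, rfl⟩ := (TopEdgeLabeling.labelGraph_adj x y).1 hxy
  exact (TopEdgeLabeling.labelGraph_adj x y).2 ⟨hne, rfl⟩

lemma HasMonochromaticCopy.of_compRight {C : TopEdgeLabeling V K} {H : SimpleGraph W} {f : K → K'}
    {g : K' → K} (hgf : ∀ e, g (f (C e)) = C e) (h : HasMonochromaticCopy (C.compRight f) H) :
    HasMonochromaticCopy C H := by
  simpa only [show (C.compRight f).compRight g = C from funext hgf] using h.compRight g

lemma HasRainbowCopy.card_edgeSet_le [Finite K] {C : TopEdgeLabeling V K} {f : K → K'}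
    {G : SimpleGraph W} (h : HasRainbowCopy (C.compRight f) G) :
    Nat.card G.edgeSet ≤ Nat.card K := by
  obtain ⟨φ, hφ⟩ := h
  exact Nat.card_le_card_of_injective (fun e => C (φ.toHom.mapEdgeSet e))
    (Function.Injective.of_comp (f := f) hφ)

lemma edgeSet_pathGraph (n : ℕ) :
    (pathGraph (n + 1)).edgeSet = Set.range fun i : Fin n => s(i.castSucc, i.succ) := by
  refine Set.ext (Sym2.ind fun u v => ?_)
  rw [mem_edgeSet, pathGraph_adj]
  constructor
  · rintro (h | h)
    · exact ⟨⟨u, by omega⟩, by simp [h]⟩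
    · exact ⟨⟨v, by omega⟩, by simp [Fin.ext_iff, h]⟩
  · rintro ⟨i, hi⟩
    simp only [Sym2.eq_iff, Fin.ext_iff, Fin.val_castSucc, Fin.val_succ] at hi
    omega

lemma card_edgeSet_pathGraph (n : ℕ) : Nat.card (pathGraph (n + 1)).edgeSet = n := by
  rw [edgeSet_pathGraph, Nat.card_range_of_injective, Nat.card_fin]
  intro i j hij
  simp only [Sym2.eq_iff, Fin.ext_iff, Fin.val_castSucc, Fin.val_succ] at hij
  omega

lemma hasRainbowCopy_pathGraph {C : TopEdgeLabeling V K} {n : ℕ} (x : Fin (n + 1) ↪ V)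
    (hx : Function.Injective fun i : Fin n =>
      C.get (x i.castSucc) (x i.succ) (x.injective.ne i.castSucc_lt_succ.ne)) :
    HasRainbowCopy C (pathGraph (n + 1)) := by
  refine ⟨⟨⟨x, fun h => x.injective.ne h.ne⟩, x.injective⟩, ?_⟩
  rintro ⟨e, he⟩ ⟨e', he'⟩ h
  obtain ⟨i, rfl⟩ : e ∈ Set.range fun i : Fin n => s(i.castSucc, i.succ) := edgeSet_pathGraph n ▸ he
  obtain ⟨j, rfl⟩ : e' ∈ Set.range fun i : Fin n => s(i.castSucc, i.succ) :=
    edgeSet_pathGraph n ▸ he'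
  exact Subtype.ext (congrArg (fun i : Fin n => s(i.castSucc, i.succ)) (hx h))

lemma rainbowPathFree_of_not_hasRainbowCopy {c : V → V → K} {hc : ∀ x y, c x y = c y x}
    (h : ¬ HasRainbowCopy (labeling c hc) (pathGraph 5)) : RainbowPathFree c := by
  intro x₁ x₂ x₃ x₄ x₅ hx hcol
  refine h (hasRainbowCopy_pathGraph ⟨![x₁, x₂, x₃, x₄, x₅], List.nodup_ofFn.1 (by simpa using hx)⟩
    (List.nodup_ofFn.1 ?_))
  simpa [labeling, EdgeLabeling.get_mk] using hcol

end Rainbow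

section Assembly
variable {V W K : Type*} {H : SimpleGraph W} {a m : ℕ}

lemma UsesAtMostThreeColors.hasMonochromaticCopy {c : V → V → K} {hc : ∀ x y, c x y = c y x}
    (h : UsesAtMostThreeColors c)
    (hR : ∀ C : TopEdgeLabeling V (Fin 3), HasMonochromaticCopy C H) :
    HasMonochromaticCopy (labeling c hc) H := by
  obtain ⟨g, hg⟩ := h
  refine .of_compRight (f := Function.invFun g) (g := g) (fun e => ?_) (hR _)
  obtain ⟨⟨x, y⟩, hxy⟩ := e
  exact Function.invFun_eq (hg x y hxy)

lemma NearlyMonochromatic.hasMonochromaticCopy [Fintype V] [Finite W] {c : V → V → K}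
    {hc : ∀ x y, c x y = c y x} (h : NearlyMonochromatic c) (hV : Nat.card W + 5 ≤ Fintype.card V) :
    HasMonochromaticCopy (labeling c hc) H := by
  classical
  obtain ⟨S, d, hS, hcol⟩ := h
  refine ⟨d, isContained_of_isClique (S := Sᶜ) (fun x hx y hy hxy => labelGraph_labeling_adj.2
    ⟨hxy, hcol x (by simpa using hx) y (by simpa using hy) hxy⟩) H ?_⟩
  rw [card_compl]
  omega

theorem IsBalancedTripartite.hasRainbowCopy_or_hasMonochromaticCopy [Finite V] [Finite W]
    [Nonempty K] (hH : IsBalancedTripartite H a) (hm : 2 ≤ m)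
    (hR : ∀ C : TopEdgeLabeling V (Fin 3), HasMonochromaticCopy C (disjointCopies m H))
    (C : TopEdgeLabeling V K) :
    HasRainbowCopy C (pathGraph 5) ∨ HasMonochromaticCopy C (disjointCopies m H) := by
  classical
  have := Fintype.ofFinite V
  have := Fintype.ofFinite W
  refine or_iff_not_imp_left.2 fun hrainbow => ?_
  obtain ⟨c, hc, rfl⟩ := exists_eq_labeling C
  have hV := hH.le_card_add_two hR
  have ha := hH.one_le
  by_cases hthree : UsesAtMostThreeColors c
  · exact hthree.hasMonochromaticCopy hR
  by_cases hN : NearlyMonochromatic c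
  · refine hN.hasMonochromaticCopy ?_
    rw [Nat.card_eq_fintype_card, Fintype.card_prod, Fintype.card_fin, hH.card_eq]
    nlinarith
  obtain ⟨D, π, hdom⟩ := (rainbowPathFree_of_not_hasRainbowCopy hrainbow).exists_isDominantColor hc
    (by rw [ENat.card_eq_coe_fintype_card]; norm_cast; nlinarith) hthree hN
  exact hdom.exists_isContained hH hR hV

theorem IsBalancedTripartite.gallaiRamseySet_eq_ramseySet [Finite W] {k : ℕ}
    (hH : IsBalancedTripartite H a) (hm : 2 ≤ m) (hk : 3 ≤ k) :
    gallaiRamseySet k (pathGraph 5) (disjointCopies m H) = ramseySet 3 (disjointCopies m H) := by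
  have : NeZero k := ⟨by omega⟩
  refine Set.Subset.antisymm (fun n hn C => ?_) fun n hn =>
    hH.hasRainbowCopy_or_hasMonochromaticCopy hm hn
  obtain h | h := hn (C.compRight (Fin.castLE hk))
  · have := card_edgeSet_pathGraph 4 ▸ h.card_edgeSet_le
    exact absurd this (by simp)
  · exact h.of_compRight (g := Function.invFun (Fin.castLE hk)) fun e =>
      Function.leftInverse_invFun (Fin.castLE_injective hk) _

lemma isBalancedTripartite_completeGraph_three :
    IsBalancedTripartite (completeGraph (Fin 3)) 1 where
  exists_coloring := ⟨Coloring.mk id (by decide), fun j => by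
    simp only [Set.ncard_eq_toFinset_card', Coloring.colorClass]
    revert j
    decide⟩
  card_le_of_isIndepSet s hs := card_le_one.2 fun x hx y hy => by
    by_contra hxy
    exact hs hx hy hxy hxy

lemma isBalancedTripartite_cycleGraph_five : IsBalancedTripartite (cycleGraph 5) 2 where
  exists_coloring := ⟨Coloring.mk ![0, 1, 0, 1, 2] (by decide), fun j => by
    simp only [Set.ncard_eq_toFinset_card', Coloring.colorClass]
    revert j
    decide⟩
  card_le_of_isIndepSet := by
    unfold SimpleGraph.IsIndepSet Set.Pairwise
    decide

end Assembly
end GallaiRamsey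

theorem mainTheorem4_general {W : Type*} [Finite W] {H : SimpleGraph W} {a m k : ℕ}
    (hH : GallaiRamsey.IsBalancedTripartite H a) (hm : 2 ≤ m) (hk : 3 ≤ k) :
    (GallaiRamsey.ramseySet 3 (GallaiRamsey.disjointCopies m H)).Nonempty ∧
      (GallaiRamsey.gallaiRamseySet k (SimpleGraph.pathGraph 5)
        (GallaiRamsey.disjointCopies m H)).Nonempty ∧
      GallaiRamsey.gallaiRamseyNumber k (SimpleGraph.pathGraph 5)
          (GallaiRamsey.disjointCopies m H) =
        GallaiRamsey.ramseyNumber 3 (GallaiRamsey.disjointCopies m H) := by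
  have hset := hH.gallaiRamseySet_eq_ramseySet hm hk
  have hne := GallaiRamsey.ramseySet_nonempty 3 (GallaiRamsey.disjointCopies m H)
  exact ⟨hne, hset ▸ hne, congrArg sInf hset⟩

theorem mainTheorem4 (m k : ℕ) (hm : 2 ≤ m) (hk : 3 ≤ k) :
    ((GallaiRamsey.ramseySet 3
          (GallaiRamsey.disjointCopies m (SimpleGraph.completeGraph (Fin 3)))).Nonempty ∧
      (GallaiRamsey.gallaiRamseySet k (SimpleGraph.pathGraph 5)
          (GallaiRamsey.disjointCopies m (SimpleGraph.completeGraph (Fin 3)))).Nonempty ∧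
      GallaiRamsey.gallaiRamseyNumber k (SimpleGraph.pathGraph 5)
          (GallaiRamsey.disjointCopies m (SimpleGraph.completeGraph (Fin 3))) =
        GallaiRamsey.ramseyNumber 3
          (GallaiRamsey.disjointCopies m (SimpleGraph.completeGraph (Fin 3)))) ∧
    ((GallaiRamsey.ramseySet 3
          (GallaiRamsey.disjointCopies m (SimpleGraph.cycleGraph 5))).Nonempty ∧
      (GallaiRamsey.gallaiRamseySet k (SimpleGraph.pathGraph 5)
          (GallaiRamsey.disjointCopies m (SimpleGraph.cycleGraph 5))).Nonempty ∧
      GallaiRamsey.gallaiRamseyNumber k (SimpleGraph.pathGraph 5)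
          (GallaiRamsey.disjointCopies m (SimpleGraph.cycleGraph 5)) =
        GallaiRamsey.ramseyNumber 3
          (GallaiRamsey.disjointCopies m (SimpleGraph.cycleGraph 5))) :=
  ⟨mainTheorem4_general GallaiRamsey.isBalancedTripartite_completeGraph_three hm hk,
    mainTheorem4_general GallaiRamsey.isBalancedTripartite_cycleGraph_five hm hk⟩
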